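/- Fix a first-order signature $\sigma$ and a countably infinite set of individual variables. Formulas are in negation normal form. Let $\mathrm{FO}(\bot)[\sigma]$ (conditional independence logic) be the set of formulas built from first-order literals (equalities and relation atoms between $\sigma$-terms, and their negations) and conditional independence atoms $\vec t_2\mathbin{\bot}_{\vec t_1}\vec t_3$ (where $\vec t_1,\vec t_2,\vec t_3$ are finite, possibly empty, tuples of $\sigma$-terms) by means of $\lor,\land,\exists v,\forall v$; let $\mathrm{FO}(\bot,\mathsf F)[\sigma]$ be defined in the same way, with the additional rule that if $\varphi$ is a formula, so is $\mathsf F\varphi$, where $\mathrm{FV}(\mathsf F\varphi)=\mathrm{FV}(\varphi)$. Let $\mathfrak M$ be a $\sigma$-model with non-empty domain $M$. A team over $\mathfrak M$ is a set $X$ of assignments $s:\operatorname{dom}(X)\to M$ for a fixed set $\operatorname{dom}(X)$ of variables. For teams with $\operatorname{dom}(X)\supseteq\mathrm{FV}(\varphi)$, satisfaction $\mathfrak M\models_X\varphi$ is given by lax team semantics: - for a literal $\alpha$: $\mathfrak M\models_X\alpha$ iff every $s\in X$ satisfies $\alpha$ in the Tarskian sense; - $\mathfrak M\models_X\vec t_2\mathbin{\bot}_{\vec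 t_1}\vec t_3$ iff for all $s,s'\in X$ with $s(\vec t_1)=s'(\vec t_1)$ there is $s''\in X$ with $s''(\vec t_1\vec t_2)=s(\vec t_1\vec t_2)$ and $s''(\vec t_1\vec t_3)=s'(\vec t_1\vec t_3)$; - $\mathfrak M\models_X\psi_1\lor\psi_2$ iff $X=Y\cup Z$ for some $Y,Z$ with $\mathfrak M\models_Y\psi_1$ and $\mathfrak M\models_Z\psi_2$; - $\mathfrak M\models_X\psi_1\land\psi_2$ iff $\mathfrak M\models_X\psi_1$ and $\mathfrak M\models_X\psi_2$; - $\mathfrak M\models_X\exists v\,\psi$ iff there is a function $H$ from $X$ to the non-empty subsets of $M$ such that $\mathfrak M\models_{X[H/v]}\psi$, where $X[H/v]=\{s[m/v] : s\in X,\ m\in H(s)\}$; - $\mathfrak M\models_X\forall v\,\psi$ iff $\mathfrak M\models_{X[M/v]}\psi$, where $X[M/v]=\{s[m/v] : s\in X,\ m\in M\}$; - $\mathfrak M\models_X\mathsf F\psi$ iff $\mathfrak M\models_{\{s\}}\psi$ for all $s\in X$. Two formulas $\varphi,\psi$ are logically equivalent if $\mathfrak M\models_X\varphi\iff\mathfrak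 M\models_X\psi$ for all models $\mathfrak M$ and all teams $X$ over $\mathfrak M$ with $\operatorname{dom}(X)\supseteq\mathrm{FV}(\varphi)\cup\mathrm{FV}(\psi)$. Then the flattening operator $\mathsf F$ does not increase the expressive power of conditional independence logic, i.e. $\mathrm{FO}(\bot,\mathsf F)\equiv\mathrm{FO}(\bot)$: for every formula $\varphi\in\mathrm{FO}(\bot,\mathsf F)[\sigma]$ there is a logically equivalent formula $\psi\in\mathrm{FO}(\bot)[\sigma]$ with $\mathrm{FV}(\psi)\subseteq\mathrm{FV}(\varphi)$, and conversely, for every formula $\varphi\in\mathrm{FO}(\bot)[\sigma]$ there is a logically equivalent formula $\psi\in\mathrm{FO}(\bot,\mathsf F)[\sigma]$ with $\mathrm{FV}(\psi)\subseteq\mathrm{FV}(\varphi)$. -/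

import Mathlib

universe u v w

namespace TeamLogic

/-- Formulas, in negation normal form, of first-order logic over the signature `L` extended by
conditional independence atoms and by the flattening operator. The individual variables are the
natural numbers. `indep t₁ t₂ t₃` is the atom "`t₂` is independent of `t₃` given `t₁`". -/
inductive TeamFormula (L : FirstOrder.Language.{u, v}) : Type (max u v)
  | eq (t₁ t₂ : L.Term ℕ) : TeamFormula L
  | neq (t₁ t₂ : L.Term ℕ) : TeamFormula L
  | rel {n : ℕ} (R : L.Relations n) (t : Fin n → L.Term ℕ) : TeamFormula L
  | nrel {n : ℕ} (R : L.Relations n) (t : Fin n → L.Term ℕ) : TeamFormula L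
  | indep {k₁ k₂ k₃ : ℕ} (t₁ : Fin k₁ → L.Term ℕ) (t₂ : Fin k₂ → L.Term ℕ)
      (t₃ : Fin k₃ → L.Term ℕ) : TeamFormula L
  | or (φ ψ : TeamFormula L) : TeamFormula L
  | and (φ ψ : TeamFormula L) : TeamFormula L
  | ex (x : ℕ) (φ : TeamFormula L) : TeamFormula L
  | all (x : ℕ) (φ : TeamFormula L) : TeamFormula L
  | flat (φ : TeamFormula L) : TeamFormula L

variable {L : FirstOrder.Language.{u, v}}

/-- The variables occurring in a tuple of terms. -/
def tupleVars {n : ℕ} (t : Fin n → L.Term ℕ) : Finset ℕ :=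
  Finset.univ.biUnion fun i => (t i).varFinset

/-- The free variables of a formula. -/
def TeamFormula.freeVars : TeamFormula L → Finset ℕ
  | .eq t₁ t₂ => t₁.varFinset ∪ t₂.varFinset
  | .neq t₁ t₂ => t₁.varFinset ∪ t₂.varFinset
  | .rel _ t => tupleVars t
  | .nrel _ t => tupleVars t
  | .indep t₁ t₂ t₃ => tupleVars t₁ ∪ tupleVars t₂ ∪ tupleVars t₃
  | .or φ ψ => φ.freeVars ∪ ψ.freeVars
  | .and φ ψ => φ.freeVars ∪ ψ.freeVars
  | .ex x φ => φ.freeVars.erase x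
  | .all x φ => φ.freeVars.erase x
  | .flat φ => φ.freeVars

/-- The flattening operator does not occur in the formula. -/
def TeamFormula.FlatFree : TeamFormula L → Prop
  | .eq _ _ => True
  | .neq _ _ => True
  | .rel _ _ => True
  | .nrel _ _ => True
  | .indep _ _ _ => True
  | .or φ ψ => φ.FlatFree ∧ ψ.FlatFree
  | .and φ ψ => φ.FlatFree ∧ ψ.FlatFree
  | .ex _ φ => φ.FlatFree
  | .all _ φ => φ.FlatFree
  | .flat _ => False

/-- Conditional independence logic over the signature `L`. -/
def IndependenceLogic (L : FirstOrder.Language.{u, v}) : Set (TeamFormula L) :=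
  {φ | φ.FlatFree}

/-- Conditional independence logic with the flattening operator, over the signature `L`. -/
def IndependenceLogicFlat (L : FirstOrder.Language.{u, v}) : Set (TeamFormula L) :=
  Set.univ

/-- An assignment into `M` with domain `D`. A team with domain `D` is a set of these. -/
abbrev Assignment (D : Set ℕ) (M : Type w) : Type w := D → M

variable {M : Type w} {D : Set ℕ}

/-- The assignment `s[m/x]`, whose domain is `D ∪ {x}`. -/
def Assignment.update (s : Assignment D M) (x : ℕ) (m : M) : Assignment (insert x D) M :=
  fun y => if h : (y : ℕ) = x then m else s ⟨y, Set.mem_of_mem_insert_of_ne y.2 h⟩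

/-- The duplication `X[M/x]` of a team. -/
def duplication (X : Set (Assignment D M)) (x : ℕ) : Set (Assignment (insert x D) M) :=
  {s' | ∃ s ∈ X, ∃ m : M, s' = s.update x m}

/-- The supplementation `X[H/x]` of a team by a function `H` on the team with sets as values. -/
def supplementation (X : Set (Assignment D M)) (x : ℕ) (H : X → Set M) :
    Set (Assignment (insert x D) M) :=
  {s' | ∃ s : X, ∃ m ∈ H s, s' = (s : Assignment D M).update x m}

open Classical in
/-- The value of a term under an assignment. It is only used for terms whose variables all lie in
`D`; variables outside `D` are given an irrelevant default value. -/
noncomputable def Assignment.eval [L.Structure M] [Nonempty M] (s : Assignment D M)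
    (t : L.Term ℕ) : M :=
  t.realize fun x => if h : x ∈ D then s ⟨x, h⟩ else Classical.arbitrary M

/-- Lax team semantics: `Sat φ X` says that the model `M` and the team `X` with domain `D` satisfy
`φ`. It is only meaningful if `D` contains the free variables of `φ`. -/
def Sat [L.Structure M] [Nonempty M] :
    TeamFormula L → {D : Set ℕ} → Set (Assignment D M) → Prop
  | .eq t₁ t₂, _, X => ∀ s ∈ X, s.eval t₁ = s.eval t₂
  | .neq t₁ t₂, _, X => ∀ s ∈ X, s.eval t₁ ≠ s.eval t₂
  | .rel R t, _, X => ∀ s ∈ X, FirstOrder.Language.Structure.RelMap R fun i => s.eval (t i)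
  | .nrel R t, _, X => ∀ s ∈ X, ¬ FirstOrder.Language.Structure.RelMap R fun i => s.eval (t i)
  | .indep t₁ t₂ t₃, _, X => ∀ s ∈ X, ∀ s' ∈ X, (∀ i, s.eval (t₁ i) = s'.eval (t₁ i)) →
      ∃ s'' ∈ X,
        ((∀ i, s''.eval (t₁ i) = s.eval (t₁ i)) ∧ ∀ i, s''.eval (t₂ i) = s.eval (t₂ i)) ∧
        ((∀ i, s''.eval (t₁ i) = s'.eval (t₁ i)) ∧ ∀ i, s''.eval (t₃ i) = s'.eval (t₃ i))
  | .or φ ψ, _, X => ∃ Y Z, X = Y ∪ Z ∧ Sat φ Y ∧ Sat ψ Z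
  | .and φ ψ, _, X => Sat φ X ∧ Sat ψ X
  | .ex x φ, _, X => ∃ H : X → Set M, (∀ s, (H s).Nonempty) ∧ Sat φ (supplementation X x H)
  | .all x φ, _, X => Sat φ (duplication X x)
  | .flat φ, _, X => ∀ s ∈ X, Sat φ {s}

/-- Logical equivalence: `φ` and `ψ` are satisfied by the same teams, over all models and for all
team domains that contain the free variables of both. -/
def LogicallyEquivalent (φ ψ : TeamFormula L) : Prop :=
  ∀ (M : Type w) [L.Structure M] [Nonempty M] (D : Set ℕ),
    (φ.freeVars : Set ℕ) ⊆ D → (ψ.freeVars : Set ℕ) ⊆ D →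
      ∀ X : Set (Assignment D M), Sat φ X ↔ Sat ψ X

/-- `𝓛₂` is at least as expressive as `𝓛₁`: every formula of `𝓛₁` is logically equivalent to a
formula of `𝓛₂` without additional free variables. -/
def ExpressibleIn (𝓛₁ 𝓛₂ : Set (TeamFormula L)) : Prop :=
  ∀ φ ∈ 𝓛₁, ∃ ψ ∈ 𝓛₂, ψ.freeVars ⊆ φ.freeVars ∧ LogicallyEquivalent.{u, v, w} φ ψ

/-- Two logics have the same expressive power (on the level of formulas). -/
def SameExpressivePower (𝓛₁ 𝓛₂ : Set (TeamFormula L)) : Prop :=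
  ExpressibleIn.{u, v, w} 𝓛₁ 𝓛₂ ∧ ExpressibleIn.{u, v, w} 𝓛₂ 𝓛₁

end TeamLogic

/-! Only the elimination of `flat` needs proof. `flat φ` asks for `φ` on each singleton `{s}`. By
locality (`AgreeOn.totalSat_iff`), `{s}` may be replaced by the set of all members of the team that
agree with `s` on the free variables of `φ`. So it is enough to express "`φ` holds on every such
class".

For one variable `q`, putting `q` into the condition of every independence atom makes the atoms
compare only assignments with equal `q`. If `q` is never quantified, fibres of `q` stay separate and
witnesses on different fibres glue, so the new formula holds iff `φ` holds on each fibre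
(`totalSat_conditionOn_iff`). A variable `x` that is quantified in `φ` is first copied to a fresh
`q` by `∃ q (q = x ∧ …)`. Iterating over the free variables of `φ` gives `exists_totalSat_iff_flat`.
-/

namespace TeamLogic

open FirstOrder

/-! ### Team semantics over total assignments -/

section TotalTeams

variable {L : FirstOrder.Language.{u, v}} {M : Type w}

/-- The supplementation of a team of total assignments. -/
def totalSupplementation (X : Set (ℕ → M)) (x : ℕ) (H : (ℕ → M) → Set M) : Set (ℕ → M) :=
  {s' | ∃ s ∈ X, ∃ m ∈ H s, s' = Function.update s x m}

/-- Lax team semantics for teams of total assignments. -/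
def TotalSat [L.Structure M] : TeamFormula L → Set (ℕ → M) → Prop
  | .eq t₁ t₂, X => ∀ s ∈ X, t₁.realize s = t₂.realize s
  | .neq t₁ t₂, X => ∀ s ∈ X, t₁.realize s ≠ t₂.realize s
  | .rel R t, X => ∀ s ∈ X, Language.Structure.RelMap R fun i => (t i).realize s
  | .nrel R t, X => ∀ s ∈ X, ¬ Language.Structure.RelMap R fun i => (t i).realize s
  | .indep t₁ t₂ t₃, X => ∀ s ∈ X, ∀ s' ∈ X,
      (∀ i, (t₁ i).realize s = (t₁ i).realize s') →
      ∃ s'' ∈ X,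
        ((∀ i, (t₁ i).realize s'' = (t₁ i).realize s) ∧
          ∀ i, (t₂ i).realize s'' = (t₂ i).realize s) ∧
        ((∀ i, (t₁ i).realize s'' = (t₁ i).realize s') ∧
          ∀ i, (t₃ i).realize s'' = (t₃ i).realize s')
  | .or φ ψ, X => ∃ Y Z, X = Y ∪ Z ∧ TotalSat φ Y ∧ TotalSat ψ Z
  | .and φ ψ, X => TotalSat φ X ∧ TotalSat ψ X
  | .ex x φ, X => ∃ H : (ℕ → M) → Set M, (∀ s ∈ X, (H s).Nonempty) ∧
      TotalSat φ (totalSupplementation X x H)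
  | .all x φ, X => TotalSat φ (totalSupplementation X x fun _ => Set.univ)
  | .flat φ, X => ∀ s ∈ X, TotalSat φ {s}

/-! ### Comparison with teams of partial assignments -/

section Extend

variable [Nonempty M] {D : Set ℕ}

open Classical in
/-- The extension of an assignment by a default value outside its domain. -/
noncomputable def Assignment.extend (s : Assignment D M) : ℕ → M :=
  fun x => if h : x ∈ D then s ⟨x, h⟩ else Classical.arbitrary M

theorem Assignment.extend_injective :
    Function.Injective (Assignment.extend : Assignment D M → ℕ → M) := by
  intro s t h
  funext x
  have := congrFun h x
  simpa [Assignment.extend, x.2] using this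

theorem Assignment.extend_update (s : Assignment D M) (x : ℕ) (m : M) :
    (s.update x m).extend = Function.update s.extend x m := by
  funext y
  by_cases h : y = x
  · subst h
    simp [Assignment.extend, Assignment.update]
  · by_cases hy : y ∈ D <;>
      simp [Assignment.extend, Assignment.update, h, hy]

theorem Assignment.eval_eq_realize_extend [L.Structure M] (s : Assignment D M)
    (t : L.Term ℕ) : s.eval t = t.realize s.extend := rfl

theorem extend_image_supplementation (X : Set (Assignment D M)) (x : ℕ) (H : X → Set M)
    (K : (ℕ → M) → Set M) (hK : ∀ s : X, K (s : Assignment D M).extend = H s) :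
    Assignment.extend '' supplementation X x H =
      totalSupplementation (Assignment.extend '' X) x K := by
  ext s'
  constructor
  · rintro ⟨_, ⟨s, m, hm, rfl⟩, rfl⟩
    exact ⟨_, ⟨s, s.2, rfl⟩, m, by rwa [hK], Assignment.extend_update _ _ _⟩
  · rintro ⟨_, ⟨s, hs, rfl⟩, m, hm, rfl⟩
    exact ⟨_, ⟨⟨s, hs⟩, m, by rwa [hK ⟨s, hs⟩] at hm, rfl⟩, Assignment.extend_update _ _ _⟩

theorem extend_image_duplication (X : Set (Assignment D M)) (x : ℕ) :
    Assignment.extend '' duplication X x =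
      totalSupplementation (Assignment.extend '' X) x fun _ => Set.univ := by
  ext s'
  constructor
  · rintro ⟨_, ⟨s, hs, m, rfl⟩, rfl⟩
    exact ⟨_, ⟨s, hs, rfl⟩, m, trivial, Assignment.extend_update _ _ _⟩
  · rintro ⟨_, ⟨s, hs, rfl⟩, m, -, rfl⟩
    exact ⟨_, ⟨s, hs, m, rfl⟩, Assignment.extend_update _ _ _⟩

/-- Extension by the default value is injective, commutes with updates and preserves values of
terms, so splittings and choice functions transfer both ways. -/
theorem sat_iff_totalSat_extend [L.Structure M] (φ : TeamFormula L) :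
    ∀ {D : Set ℕ} (X : Set (Assignment D M)),
      Sat φ X ↔ TotalSat φ (Assignment.extend '' X) := by
  induction φ with
  | eq | neq | rel | nrel | indep =>
    intro D X
    simp only [Sat, TotalSat, Set.forall_mem_image, Set.exists_mem_image,
      Assignment.eval_eq_realize_extend]
  | or φ ψ ihφ ihψ =>
    intro D X
    constructor
    · rintro ⟨Y, Z, rfl, hY, hZ⟩
      exact ⟨_, _, Set.image_union _ _ _, (ihφ Y).1 hY, (ihψ Z).1 hZ⟩
    · rintro ⟨Y, Z, h, hY, hZ⟩
      obtain ⟨Y', -, rfl⟩ := Set.subset_image_iff.1 (h ▸ Set.subset_union_left :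
        Y ⊆ Assignment.extend '' X)
      obtain ⟨Z', -, rfl⟩ := Set.subset_image_iff.1 (h ▸ Set.subset_union_right :
        Z ⊆ Assignment.extend '' X)
      rw [← Set.image_union] at h
      exact ⟨Y', Z', Assignment.extend_injective.image_injective h, (ihφ _).2 hY, (ihψ _).2 hZ⟩
  | and φ ψ ihφ ihψ =>
    intro D X
    exact and_congr (ihφ X) (ihψ X)
  | ex x φ ih =>
    intro D X
    constructor
    · rintro ⟨H, hne, hH⟩
      -- `H` transported along the injective extension map; `K` is empty off the image.
      let K : (ℕ → M) → Set M := fun t => {m | ∃ s : X, s.1.extend = t ∧ m ∈ H s}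
      have hK : ∀ s : X, K s.1.extend = H s := by
        intro s
        ext m
        constructor
        · rintro ⟨s', h, hm⟩
          rwa [← Subtype.ext (Assignment.extend_injective h)]
        · exact fun hm => ⟨s, rfl, hm⟩
      refine ⟨K, ?_, ?_⟩
      · rintro _ ⟨s, hs, rfl⟩
        rw [hK ⟨s, hs⟩]
        exact hne _
      · rw [← extend_image_supplementation X x H K hK]
        exact (ih _).1 hH
    · rintro ⟨K, hne, hK⟩
      refine ⟨fun s => K s.1.extend, fun s => hne _ ⟨s, s.2, rfl⟩, (ih _).2 ?_⟩
      rwa [extend_image_supplementation X x _ K fun _ => rfl]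
  | all x φ ih =>
    intro D X
    exact (ih _).trans (by rw [extend_image_duplication]; rfl)
  | flat φ ih =>
    intro D X
    simp only [Sat, TotalSat, Set.forall_mem_image]
    exact forall₂_congr fun s _ => by rw [ih, Set.image_singleton]

end Extend

/-! ### Locality and the empty team property -/

/-- Two teams have the same restriction to the variables in `V`. -/
def AgreeOn (V : Set ℕ) (X Y : Set (ℕ → M)) : Prop :=
  (∀ s ∈ X, ∃ t ∈ Y, Set.EqOn s t V) ∧ ∀ t ∈ Y, ∃ s ∈ X, Set.EqOn s t V

theorem AgreeOn.symm {V : Set ℕ} {X Y : Set (ℕ → M)} (h : AgreeOn V X Y) : AgreeOn V Y X :=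
  ⟨fun t ht => (h.2 t ht).imp fun _ hs => ⟨hs.1, hs.2.symm⟩,
    fun s hs => (h.1 s hs).imp fun _ ht => ⟨ht.1, ht.2.symm⟩⟩

theorem AgreeOn.mono {V W : Set ℕ} {X Y : Set (ℕ → M)} (h : AgreeOn V X Y) (hW : W ⊆ V) :
    AgreeOn W X Y :=
  ⟨fun s hs => (h.1 s hs).imp fun _ ht => ⟨ht.1, ht.2.mono hW⟩,
    fun t ht => (h.2 t ht).imp fun _ hs => ⟨hs.1, hs.2.mono hW⟩⟩

theorem eqOn_update {V : Set ℕ} {s t : ℕ → M} {x : ℕ} (h : Set.EqOn s t (V \ {x})) (m : M) :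
    Set.EqOn (Function.update s x m) (Function.update t x m) V := by
  intro y hy
  by_cases hyx : y = x
  · subst hyx
    simp
  · simpa [hyx] using h ⟨hy, hyx⟩

/-- The update makes the values at `x` equal, so the old assignments need only agree off `x`. -/
theorem agreeOn_totalSupplementation {V : Set ℕ} {X Y : Set (ℕ → M)} {x : ℕ}
    {H K : (ℕ → M) → Set M}
    (hHK : ∀ s ∈ X, ∀ m ∈ H s, ∃ t ∈ Y, Set.EqOn s t (V \ {x}) ∧ m ∈ K t)
    (hKH : ∀ t ∈ Y, ∀ m ∈ K t, ∃ s ∈ X, Set.EqOn s t (V \ {x}) ∧ m ∈ H s) :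
    AgreeOn V (totalSupplementation X x H) (totalSupplementation Y x K) := by
  constructor
  · rintro _ ⟨s, hs, m, hm, rfl⟩
    obtain ⟨t, ht, hst, hmt⟩ := hHK s hs m hm
    exact ⟨_, ⟨t, ht, m, hmt, rfl⟩, eqOn_update hst m⟩
  · rintro _ ⟨t, ht, m, hm, rfl⟩
    obtain ⟨s, hs, hst, hms⟩ := hKH t ht m hm
    exact ⟨_, ⟨s, hs, m, hms, rfl⟩, eqOn_update hst m⟩

theorem realize_eq_of_eqOn [L.Structure M] {V : Set ℕ} {s t : ℕ → M} (h : Set.EqOn s t V)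
    (τ : L.Term ℕ) (hτ : (τ.varFinset : Set ℕ) ⊆ V) : τ.realize s = τ.realize t := by
  induction τ with
  | var x => exact h (hτ (by simp [Language.Term.varFinset]))
  | func f ts ih =>
    simp only [Language.Term.realize]
    congr 1
    funext i
    refine ih i fun x hx => hτ ?_
    simp only [Language.Term.varFinset, Finset.coe_biUnion, Set.mem_iUnion]
    exact ⟨i, by simp, hx⟩

theorem varFinset_subset_tupleVars {n : ℕ} (t : Fin n → L.Term ℕ) (i : Fin n) :
    (t i).varFinset ⊆ tupleVars t :=
  Finset.subset_biUnion_of_mem (fun i => (t i).varFinset) (Finset.mem_univ i)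

theorem realize_tuple_eq_of_eqOn [L.Structure M] {V : Set ℕ} {s s' : ℕ → M}
    (h : Set.EqOn s s' V) {n : ℕ} (t : Fin n → L.Term ℕ) (ht : (tupleVars t : Set ℕ) ⊆ V)
    (i : Fin n) : (t i).realize s = (t i).realize s' :=
  realize_eq_of_eqOn h _ ((Finset.coe_subset.2 (varFinset_subset_tupleVars t i)).trans ht)

/-- Satisfaction is preserved under replacing the team by one with the same restriction to the
free variables. -/
theorem TotalSat.of_agreeOn [L.Structure M] {φ : TeamFormula L} {X Y : Set (ℕ → M)}
    (h : AgreeOn φ.freeVars X Y) (hX : TotalSat φ X) : TotalSat φ Y := by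
  induction φ generalizing X Y with
  | eq t₁ t₂ =>
    intro t ht
    obtain ⟨s, hs, hst⟩ := h.2 t ht
    rw [← realize_eq_of_eqOn hst t₁ (by simp [TeamFormula.freeVars]),
      ← realize_eq_of_eqOn hst t₂ (by simp [TeamFormula.freeVars])]
    exact hX s hs
  | neq t₁ t₂ =>
    intro t ht
    obtain ⟨s, hs, hst⟩ := h.2 t ht
    rw [← realize_eq_of_eqOn hst t₁ (by simp [TeamFormula.freeVars]),
      ← realize_eq_of_eqOn hst t₂ (by simp [TeamFormula.freeVars])]
    exact hX s hs
  | rel R τ =>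
    intro t ht
    obtain ⟨s, hs, hst⟩ := h.2 t ht
    simpa only [realize_tuple_eq_of_eqOn hst τ subset_rfl] using hX s hs
  | nrel R τ =>
    intro t ht
    obtain ⟨s, hs, hst⟩ := h.2 t ht
    simpa only [realize_tuple_eq_of_eqOn hst τ subset_rfl] using hX s hs
  | indep t₁ t₂ t₃ =>
    have key : ∀ {s t : ℕ → M}, Set.EqOn s t (TeamFormula.indep t₁ t₂ t₃).freeVars →
        (∀ i, (t₁ i).realize s = (t₁ i).realize t) ∧
        (∀ i, (t₂ i).realize s = (t₂ i).realize t) ∧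
        (∀ i, (t₃ i).realize s = (t₃ i).realize t) := fun hst =>
      ⟨realize_tuple_eq_of_eqOn hst t₁ (fun x hx => by simp_all [TeamFormula.freeVars]),
        realize_tuple_eq_of_eqOn hst t₂ (fun x hx => by simp_all [TeamFormula.freeVars]),
        realize_tuple_eq_of_eqOn hst t₃ (fun x hx => by simp_all [TeamFormula.freeVars])⟩
    intro t ht t' ht' htt'
    obtain ⟨s, hs, hst⟩ := h.2 t ht
    obtain ⟨s', hs', hst'⟩ := h.2 t' ht'
    obtain ⟨h₁, h₂, -⟩ := key hst
    obtain ⟨h₁', -, h₃'⟩ := key hst'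
    obtain ⟨s'', hs'', ⟨ha, hb⟩, hc, hd⟩ := hX s hs s' hs' fun i => by rw [h₁, h₁', htt']
    obtain ⟨t'', ht'', hst''⟩ := h.1 s'' hs''
    obtain ⟨k₁, k₂, k₃⟩ := key hst''
    exact ⟨t'', ht'', ⟨fun i => by rw [← k₁, ha, h₁], fun i => by rw [← k₂, hb, h₂]⟩,
      fun i => by rw [← k₁, hc, h₁'], fun i => by rw [← k₃, hd, h₃']⟩
  | or φ ψ ihφ ihψ =>
    obtain ⟨X₁, X₂, rfl, h₁, h₂⟩ := hX
    let V : Set ℕ := (TeamFormula.or φ ψ).freeVars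
    have hφ : (φ.freeVars : Set ℕ) ⊆ V := by simp [V, TeamFormula.freeVars]
    have hψ : (ψ.freeVars : Set ℕ) ⊆ V := by simp [V, TeamFormula.freeVars]
    -- Each half of the splitting of `Y` collects the assignments matching some member of the given
    -- half; overlaps are harmless in lax semantics.
    have key : ∀ Z ⊆ X₁ ∪ X₂, AgreeOn V Z {t ∈ Y | ∃ s ∈ Z, Set.EqOn s t V} := fun Z hZ =>
      ⟨fun s hs => by
        obtain ⟨t, ht, hst⟩ := h.1 s (hZ hs)
        exact ⟨t, ⟨ht, s, hs, hst⟩, hst⟩, fun t ht => ht.2⟩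
    refine ⟨_, _, ?_, ihφ ((key X₁ Set.subset_union_left).mono hφ) h₁,
      ihψ ((key X₂ Set.subset_union_right).mono hψ) h₂⟩
    ext t
    constructor
    · intro ht
      obtain ⟨s, hs | hs, hst⟩ := h.2 t ht
      · exact .inl ⟨ht, s, hs, hst⟩
      · exact .inr ⟨ht, s, hs, hst⟩
    · rintro (ht | ht) <;> exact ht.1
  | and φ ψ ihφ ihψ =>
    exact ⟨ihφ (h.mono (by simp [TeamFormula.freeVars])) hX.1,
      ihψ (h.mono (by simp [TeamFormula.freeVars])) hX.2⟩
  | ex x φ ih =>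
    obtain ⟨H, hne, hH⟩ := hX
    rw [TeamFormula.freeVars, Finset.coe_erase] at h
    -- Several `s` may match the same `t`; lax semantics allows taking all their values together.
    refine ⟨fun t => {m | ∃ s ∈ X, Set.EqOn s t (φ.freeVars \ {x}) ∧ m ∈ H s}, ?_,
      ih (agreeOn_totalSupplementation ?_ ?_) hH⟩
    · intro t ht
      obtain ⟨s, hs, hst⟩ := h.2 t ht
      obtain ⟨m, hm⟩ := hne s hs
      exact ⟨m, s, hs, hst, hm⟩
    · intro s hs m hm
      obtain ⟨t, ht, hst⟩ := h.1 s hs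
      exact ⟨t, ht, hst, s, hs, hst, hm⟩
    · exact fun t _ m hm => hm
  | all x φ ih =>
    rw [TeamFormula.freeVars, Finset.coe_erase] at h
    refine ih (agreeOn_totalSupplementation ?_ ?_) hX
    · exact fun s hs m _ => (h.1 s hs).imp fun t ht => ⟨ht.1, ht.2, trivial⟩
    · exact fun t ht m _ => (h.2 t ht).imp fun s hs => ⟨hs.1, hs.2, trivial⟩
  | flat φ ih =>
    intro t ht
    obtain ⟨s, hs, hst⟩ := h.2 t ht
    exact ih ⟨by simpa [TeamFormula.freeVars] using hst,
      by simpa [TeamFormula.freeVars] using hst⟩ (hX s hs)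

theorem AgreeOn.totalSat_iff [L.Structure M] {φ : TeamFormula L} {X Y : Set (ℕ → M)}
    (h : AgreeOn φ.freeVars X Y) : TotalSat φ X ↔ TotalSat φ Y :=
  ⟨.of_agreeOn h, .of_agreeOn h.symm⟩

theorem totalSat_empty [L.Structure M] (φ : TeamFormula L) : TotalSat φ (∅ : Set (ℕ → M)) := by
  induction φ with
  | or φ ψ ihφ ihψ => exact ⟨∅, ∅, by simp, ihφ, ihψ⟩
  | and φ ψ ihφ ihψ => exact ⟨ihφ, ihψ⟩
  | ex x φ ih => exact ⟨fun _ => ∅, by simp, by simpa [totalSupplementation] using ih⟩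
  | all x φ ih => simpa [TotalSat, totalSupplementation] using ih
  | _ => simp [TotalSat]

/-! ### Satisfaction in parallel on the fibres of a variable -/

/-- The variables that are quantified somewhere in a formula. -/
def TeamFormula.boundVars : TeamFormula L → Finset ℕ
  | .or φ ψ => φ.boundVars ∪ ψ.boundVars
  | .and φ ψ => φ.boundVars ∪ ψ.boundVars
  | .ex x φ => insert x φ.boundVars
  | .all x φ => insert x φ.boundVars
  | .flat φ => φ.boundVars
  | _ => ∅

/-- Adds the variable `q` to the condition of every independence atom. -/
def TeamFormula.conditionOn (q : ℕ) : TeamFormula L → TeamFormula L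
  | .indep t₁ t₂ t₃ =>
      .indep (Fin.cons (Language.Term.var q) t₁ : Fin (_ + 1) → L.Term ℕ) t₂ t₃
  | .or φ ψ => .or (φ.conditionOn q) (ψ.conditionOn q)
  | .and φ ψ => .and (φ.conditionOn q) (ψ.conditionOn q)
  | .ex x φ => .ex x (φ.conditionOn q)
  | .all x φ => .all x (φ.conditionOn q)
  | φ => φ

theorem TeamFormula.FlatFree.conditionOn {φ : TeamFormula L} (h : φ.FlatFree) (q : ℕ) :
    (φ.conditionOn q).FlatFree := by
  induction φ with
  | or φ ψ ihφ ihψ => exact ⟨ihφ h.1, ihψ h.2⟩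
  | and φ ψ ihφ ihψ => exact ⟨ihφ h.1, ihψ h.2⟩
  | ex x φ ih => exact ih h
  | all x φ ih => exact ih h
  | flat => exact h
  | _ => trivial

theorem TeamFormula.freeVars_conditionOn_subset (φ : TeamFormula L) (q : ℕ) :
    (φ.conditionOn q).freeVars ⊆ insert q φ.freeVars := by
  induction φ with
  | indep t₁ t₂ t₃ =>
    intro x hx
    simp only [conditionOn, freeVars, tupleVars, Finset.mem_union, Finset.mem_biUnion,
      Finset.mem_univ, true_and, Fin.exists_fin_succ, Fin.cons_zero, Fin.cons_succ,
      Language.Term.varFinset, Finset.mem_singleton, Finset.mem_insert] at hx ⊢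
    tauto
  | or φ ψ ihφ ihψ =>
    intro x hx
    simp only [conditionOn, freeVars, Finset.mem_union, Finset.mem_insert] at hx ⊢
    have := @ihφ x
    have := @ihψ x
    simp only [Finset.mem_insert] at *
    tauto
  | and φ ψ ihφ ihψ =>
    intro x hx
    simp only [conditionOn, freeVars, Finset.mem_union, Finset.mem_insert] at hx ⊢
    have := @ihφ x
    have := @ihψ x
    simp only [Finset.mem_insert] at *
    tauto
  | ex y φ ih =>
    intro x hx
    have := @ih x
    simp only [conditionOn, freeVars, Finset.mem_erase, Finset.mem_insert] at *
    tauto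
  | all y φ ih =>
    intro x hx
    have := @ih x
    simp only [conditionOn, freeVars, Finset.mem_erase, Finset.mem_insert] at *
    tauto
  | _ => exact Finset.subset_insert _ _

/-- The subteam of the assignments that give the variable `q` the value `a`. -/
def fibre (X : Set (ℕ → M)) (q : ℕ) (a : M) : Set (ℕ → M) := {s ∈ X | s q = a}

theorem fibre_totalSupplementation (X : Set (ℕ → M)) {x q : ℕ} (hq : q ≠ x)
    (H : (ℕ → M) → Set M) (a : M) :
    fibre (totalSupplementation X x H) q a = totalSupplementation (fibre X q a) x H := by
  ext s'
  constructor
  · rintro ⟨⟨s, hs, m, hm, rfl⟩, ha⟩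
    exact ⟨s, ⟨hs, by simpa [hq] using ha⟩, m, hm, rfl⟩
  · rintro ⟨s, ⟨hs, ha⟩, m, hm, rfl⟩
    exact ⟨⟨s, hs, m, hm, rfl⟩, by simpa [hq] using ha⟩

/-- Distinct fibres are disjoint, so pieces chosen fibre by fibre can be glued and recovered. -/
theorem fibre_iUnion {X : Set (ℕ → M)} {q : ℕ} {Y : M → Set (ℕ → M)}
    (hY : ∀ a, Y a ⊆ fibre X q a) (a : M) : fibre (⋃ b, Y b) q a = Y a := by
  ext s
  constructor
  · rintro ⟨hs, rfl⟩
    obtain ⟨b, hb⟩ := Set.mem_iUnion.1 hs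
    rwa [(hY b hb).2]
  · exact fun hs => ⟨Set.mem_iUnion.2 ⟨a, hs⟩, (hY a hs).2⟩

theorem totalSupplementation_congr {X : Set (ℕ → M)} {x : ℕ} {H K : (ℕ → M) → Set M}
    (h : ∀ s ∈ X, H s = K s) : totalSupplementation X x H = totalSupplementation X x K := by
  ext s'
  exact exists_congr fun s => and_congr_right fun hs => by rw [h s hs]

/-- Conditioning every independence atom on a variable means evaluating the formula on each fibre
of that variable. -/
theorem totalSat_conditionOn_iff [L.Structure M] {φ : TeamFormula L} (hφ : φ.FlatFree) {q : ℕ}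
    (hq : q ∉ φ.boundVars) (X : Set (ℕ → M)) :
    TotalSat (φ.conditionOn q) X ↔ ∀ a, TotalSat φ (fibre X q a) := by
  induction φ generalizing X with
  | eq | neq | rel | nrel =>
    exact ⟨fun h a s hs => h s hs.1, fun h s hs => h (s q) s ⟨hs, rfl⟩⟩
  | indep t₁ t₂ t₃ =>
    simp only [TeamFormula.conditionOn, TotalSat, Fin.forall_fin_succ, Fin.cons_zero,
      Fin.cons_succ, Language.Term.realize_var]
    constructor
    · rintro h a s ⟨hs, rfl⟩ s' ⟨hs', ha⟩ h₁
      -- The added condition `h₂` keeps the witness in the fibre.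
      obtain ⟨s'', hs'', ⟨⟨h₂, h₃⟩, h₄⟩, ⟨-, h₅⟩, h₆⟩ := h s hs s' hs' ⟨ha.symm, h₁⟩
      exact ⟨s'', ⟨hs'', h₂⟩, ⟨h₃, h₄⟩, h₅, h₆⟩
    · rintro h s hs s' hs' ⟨ha, h₁⟩
      obtain ⟨s'', ⟨hs'', h₂⟩, ⟨h₃, h₄⟩, h₅, h₆⟩ :=
        h (s q) s ⟨hs, rfl⟩ s' ⟨hs', ha.symm⟩ h₁
      exact ⟨s'', hs'', ⟨⟨h₂, h₃⟩, h₄⟩, ⟨h₂.trans ha, h₅⟩, h₆⟩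
  | or φ ψ ihφ ihψ =>
    simp only [TeamFormula.boundVars, Finset.mem_union, not_or] at hq
    constructor
    · rintro ⟨Y, Z, rfl, hY, hZ⟩ a
      refine ⟨fibre Y q a, fibre Z q a, ?_, (ihφ hφ.1 hq.1 Y).1 hY a, (ihψ hφ.2 hq.2 Z).1 hZ a⟩
      ext s
      simp only [fibre, Set.mem_ofPred_eq, Set.mem_union]
      tauto
    · intro h
      choose Y Z hX hY hZ using h
      refine ⟨⋃ a, Y a, ⋃ a, Z a, ?_, (ihφ hφ.1 hq.1 _).2 fun a => ?_,
        (ihψ hφ.2 hq.2 _).2 fun a => ?_⟩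
      · rw [← Set.iUnion_union_distrib]
        simp only [← hX]
        ext s
        simp [fibre]
      · rw [fibre_iUnion fun a => hX a ▸ Set.subset_union_left]
        exact hY a
      · rw [fibre_iUnion fun a => hX a ▸ Set.subset_union_right]
        exact hZ a
  | and φ ψ ihφ ihψ =>
    simp only [TeamFormula.boundVars, Finset.mem_union, not_or] at hq
    simp only [TeamFormula.conditionOn, TotalSat, ihφ hφ.1 hq.1, ihψ hφ.2 hq.2, forall_and]
  | ex x φ ih =>
    simp only [TeamFormula.boundVars, Finset.mem_insert, not_or] at hq
    constructor
    · rintro ⟨H, hne, hH⟩ a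
      refine ⟨H, fun s hs => hne s hs.1, ?_⟩
      rw [← fibre_totalSupplementation X hq.1]
      exact (ih hφ hq.2 _).1 hH a
    · intro h
      choose H hne hH using h
      -- Each assignment uses the choice function of its own fibre.
      refine ⟨fun s => H (s q) s, fun s hs => hne (s q) s ⟨hs, rfl⟩,
        (ih hφ hq.2 _).2 fun a => ?_⟩
      rw [fibre_totalSupplementation X hq.1,
        totalSupplementation_congr (K := H a) fun s hs => by rw [hs.2] ]
      exact hH a
  | all x φ ih =>
    simp only [TeamFormula.boundVars, Finset.mem_insert, not_or] at hq
    refine (ih hφ hq.2 _).trans (forall_congr' fun a => ?_)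
    rw [fibre_totalSupplementation X hq.1]
    rfl
  | flat φ ih => exact hφ.elim

/-! ### Elimination of the flattening operator -/

/-- A fresh copy of a variable `x` lets a formula be evaluated on each fibre of `x`, even when `x`
is quantified in the formula. -/
theorem exists_totalSat_iff_forall_fibre {φ : TeamFormula L} (hφ : φ.FlatFree) (x : ℕ) :
    ∃ ψ : TeamFormula L, ψ.FlatFree ∧ ψ.freeVars ⊆ insert x φ.freeVars ∧
      ∀ (M : Type w) [L.Structure M] (X : Set (ℕ → M)),
        TotalSat ψ X ↔ ∀ a, TotalSat φ (fibre X x a) := by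
  obtain ⟨q, hq⟩ := Infinite.exists_notMem_finset (insert x (φ.boundVars ∪ φ.freeVars))
  simp only [Finset.mem_insert, Finset.mem_union, not_or] at hq
  obtain ⟨hqx, hqb, hqf⟩ := hq
  refine ⟨.ex q (.and (.eq (.var q) (.var x)) (φ.conditionOn q)),
    ⟨trivial, hφ.conditionOn q⟩, ?_, fun M _ X => ?_⟩
  · intro y hy
    have := @TeamFormula.freeVars_conditionOn_subset _ φ q y
    simp only [TeamFormula.freeVars, Language.Term.varFinset, Finset.mem_erase,
      Finset.mem_union, Finset.mem_singleton, Finset.mem_insert] at *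
    tauto
  -- Once `q` copies `x`, the fibre of `q` over `a` is the fibre of `x` over `a`, up to values of
  -- `q`, which is not free in `φ`.
  · have agree : ∀ H : (ℕ → M) → Set M, (∀ s ∈ X, H s = {s x}) → ∀ a,
        TotalSat φ (fibre (totalSupplementation X q H) q a) ↔ TotalSat φ (fibre X x a) := by
      intro H hH a
      have eqOn : ∀ (s : ℕ → M) (m : M), Set.EqOn (Function.update s q m) s φ.freeVars :=
        fun s m y hy => Function.update_of_ne (by rintro rfl; exact hqf hy) _ _
      refine AgreeOn.totalSat_iff ⟨?_, ?_⟩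
      · rintro _ ⟨⟨s, hs, m, hm, rfl⟩, ha⟩
        rw [hH s hs] at hm
        rw [Function.update_self] at ha
        exact ⟨s, ⟨hs, hm.symm.trans ha⟩, eqOn _ _⟩
      · rintro s ⟨hs, ha⟩
        exact ⟨_, ⟨⟨s, hs, s x, by simp [hH s hs], rfl⟩, by simpa using ha⟩, eqOn _ _⟩
    constructor
    · rintro ⟨H, hne, heq, hH⟩ a
      refine (agree H (fun s hs => ?_) a).1 ((totalSat_conditionOn_iff hφ hqb _).1 hH a)
      refine (Set.Nonempty.subset_singleton_iff (hne s hs)).1 fun m hm => ?_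
      simpa [Ne.symm hqx] using heq _ ⟨s, hs, m, hm, rfl⟩
    · intro h
      refine ⟨fun s => {s x}, by simp, ?_, (totalSat_conditionOn_iff hφ hqb _).2 fun a =>
        (agree _ (fun _ _ => rfl) a).2 (h a)⟩
      rintro _ ⟨s, hs, m, hm, rfl⟩
      simpa [Ne.symm hqx] using hm

/-- Fibres of fibres are joint fibres, so the one-variable construction iterates along `l`. -/
theorem exists_totalSat_iff_forall_fibres {φ : TeamFormula L} (hφ : φ.FlatFree) (l : List ℕ) :
    ∃ ψ : TeamFormula L, ψ.FlatFree ∧ ψ.freeVars ⊆ l.toFinset ∪ φ.freeVars ∧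
      ∀ (M : Type w) [L.Structure M] (X : Set (ℕ → M)),
        TotalSat ψ X ↔ ∀ s ∈ X, TotalSat φ {t ∈ X | ∀ x ∈ l, t x = s x} := by
  induction l with
  | nil =>
    refine ⟨φ, hφ, by simp, fun M _ X => ?_⟩
    simp only [List.not_mem_nil, false_implies, implies_true, and_true, Set.ofPred_mem_eq]
    refine ⟨fun h _ _ => h, fun h => ?_⟩
    -- For empty `X` the right-hand side is vacuous, hence the empty team property.
    obtain rfl | ⟨s, hs⟩ := X.eq_empty_or_nonempty
    · exact totalSat_empty φ
    · exact h s hs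
  | cons x l ih =>
    obtain ⟨χ, hχ, hfv, hsat⟩ := ih
    obtain ⟨ψ, hψ, hfv', hsat'⟩ := exists_totalSat_iff_forall_fibre.{u, v, w} hχ x
    refine ⟨ψ, hψ, hfv'.trans ?_, fun M _ X => ?_⟩
    · rw [List.toFinset_cons, Finset.insert_union]
      exact Finset.insert_subset_insert x hfv
    · simp only [hsat', hsat]
      have key : ∀ s : ℕ → M, {t ∈ fibre X x (s x) | ∀ y ∈ l, t y = s y} =
          {t ∈ X | ∀ y ∈ x :: l, t y = s y} := by
        intro s
        ext t
        simp [fibre, and_assoc]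
      constructor
      · intro h s hs
        rw [← key]
        exact h (s x) s ⟨hs, rfl⟩
      · rintro h _ s ⟨hs, rfl⟩
        rw [key]
        exact h s hs

/-- The flattening of a formula of independence logic is expressible in independence logic. -/
theorem exists_totalSat_iff_flat {φ : TeamFormula L} (hφ : φ.FlatFree) :
    ∃ ψ : TeamFormula L, ψ.FlatFree ∧ ψ.freeVars ⊆ φ.freeVars ∧
      ∀ (M : Type w) [L.Structure M] (X : Set (ℕ → M)), TotalSat φ.flat X ↔ TotalSat ψ X := by
  obtain ⟨ψ, hψ, hfv, hsat⟩ :=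
    exists_totalSat_iff_forall_fibres.{u, v, w} hφ φ.freeVars.toList
  refine ⟨ψ, hψ, by simpa using hfv, fun M _ X => ?_⟩
  rw [hsat, TotalSat]
  -- All members of the class of `s` agree with `s` on the free variables, so locality identifies it
  -- with `{s}`.
  refine forall₂_congr fun s hs => AgreeOn.totalSat_iff ⟨?_, ?_⟩
  · rintro _ rfl
    exact ⟨_, ⟨hs, fun _ _ => rfl⟩, fun _ _ => rfl⟩
  · rintro t ⟨-, ht⟩
    exact ⟨s, rfl, fun x hx => (ht x (by simpa using hx)).symm⟩

/-- Flattening is removed from the inside out, since its elimination requires a flat-free argument.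
-/
theorem exists_flatFree_totalSat_iff (φ : TeamFormula L) :
    ∃ ψ : TeamFormula L, ψ.FlatFree ∧ ψ.freeVars ⊆ φ.freeVars ∧
      ∀ (M : Type w) [L.Structure M] (X : Set (ℕ → M)), TotalSat φ X ↔ TotalSat ψ X := by
  induction φ with
  | or φ ψ ihφ ihψ =>
    obtain ⟨φ', hφ, fφ, eφ⟩ := ihφ
    obtain ⟨ψ', hψ, fψ, eψ⟩ := ihψ
    exact ⟨.or φ' ψ', ⟨hφ, hψ⟩, Finset.union_subset_union fφ fψ, fun M _ X => by
      simp only [TotalSat, eφ, eψ]⟩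
  | and φ ψ ihφ ihψ =>
    obtain ⟨φ', hφ, fφ, eφ⟩ := ihφ
    obtain ⟨ψ', hψ, fψ, eψ⟩ := ihψ
    exact ⟨.and φ' ψ', ⟨hφ, hψ⟩, Finset.union_subset_union fφ fψ, fun M _ X => by
      simp only [TotalSat, eφ, eψ]⟩
  | ex x φ ih =>
    obtain ⟨φ', hφ, fφ, eφ⟩ := ih
    exact ⟨.ex x φ', hφ, Finset.erase_subset_erase x fφ, fun M _ X => by
      simp only [TotalSat, eφ]⟩
  | all x φ ih =>
    obtain ⟨φ', hφ, fφ, eφ⟩ := ih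
    exact ⟨.all x φ', hφ, Finset.erase_subset_erase x fφ, fun M _ X => by
      simp only [TotalSat, eφ]⟩
  | flat φ ih =>
    obtain ⟨φ', hφ, fφ, eφ⟩ := ih
    obtain ⟨ψ, hψ, fψ, eψ⟩ := exists_totalSat_iff_flat.{u, v, w} hφ
    exact ⟨ψ, hψ, fψ.trans fφ, fun M _ X => by simp only [← eψ, TotalSat, eφ]⟩
  | eq t₁ t₂ => exact ⟨.eq t₁ t₂, trivial, subset_rfl, fun M _ X => Iff.rfl⟩
  | neq t₁ t₂ => exact ⟨.neq t₁ t₂, trivial, subset_rfl, fun M _ X => Iff.rfl⟩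
  | rel R t => exact ⟨.rel R t, trivial, subset_rfl, fun M _ X => Iff.rfl⟩
  | nrel R t => exact ⟨.nrel R t, trivial, subset_rfl, fun M _ X => Iff.rfl⟩
  | indep t₁ t₂ t₃ => exact ⟨.indep t₁ t₂ t₃, trivial, subset_rfl, fun M _ X => Iff.rfl⟩

end TotalTeams

end TeamLogic

theorem mainTheorem6 (L : FirstOrder.Language.{u, v}) :
    TeamLogic.SameExpressivePower.{u, v, w}
      (TeamLogic.IndependenceLogicFlat L) (TeamLogic.IndependenceLogic L) := by
  refine ⟨fun φ _ => ?_, fun φ _ =>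
    ⟨φ, Set.mem_univ φ, subset_rfl, fun _ _ _ _ _ _ _ => Iff.rfl⟩⟩
  obtain ⟨ψ, hψ, hfv, hsat⟩ := TeamLogic.exists_flatFree_totalSat_iff.{u, v, w} φ
  refine ⟨ψ, hψ, hfv, fun M _ _ D _ _ X => ?_⟩
  rw [TeamLogic.sat_iff_totalSat_extend, TeamLogic.sat_iff_totalSat_extend, hsat]
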